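/- **Universal Isomorphism Theorem.** *Context.* Let $\mathcal C$ be a category; call its objects groups and its morphisms homomorphisms. Suppose that every group $G$ is equipped with a bounded lattice $\mathsf{Sub}\,G$ of "subgroups", with order $\subseteq$, least element $1$ and largest element $G$, and that every homomorphism $f\colon X\to Y$ is equipped with a direct image map $A\mapsto fA$ from $\mathsf{Sub}\,X$ to $\mathsf{Sub}\,Y$ and an inverse image map $B\mapsto f^{-1}B$ from $\mathsf{Sub}\,Y$ to $\mathsf{Sub}\,X$. Put $\mathsf{Im} f=fX$ and $\mathsf{Ker} f=f^{-1}1$. A subgroup of $G$ is *normal* if it is the kernel of some homomorphism with domain $G$, and *conormal* if it is the image of some homomorphism with codomain $G$. An *embedding associated to* $S\in\mathsf{Sub}\,G$ is a homomorphism $m\colon M\to G$ with $\mathsf{Im}\,m\subseteq S$ such that every homomorphism $f\colon U\to G$ with $\mathsf{Im} f\subseteq S$ is $f=mu$ for a unique $u\colon U\to M$. A *projection associated to* $S\in\mathsf{Sub}\,G$ is a homomorphism $p\colon G\to Q$ with $S\subseteq\mathsf{Ker}\,p$ such that every homomorphism $g\colon G\to V$ with $S\subseteq\mathsf{Ker}\,g$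 is $g=vp$ for a unique $v\colon Q\to V$. Assume the following axioms. 1. $fA\subseteq B\Leftrightarrow A\subseteq f^{-1}B$; moreover $1_GA=A=1_G^{-1}A$, $(fg)A=f(gA)$ and $(fg)^{-1}B=g^{-1}(f^{-1}B)$. 2. $ff^{-1}B=B\wedge\mathsf{Im} f$ and $f^{-1}fA=A\vee\mathsf{Ker} f$. 3. Every conormal subgroup has an associated embedding, and every normal subgroup has an associated projection. 4. Every homomorphism $f$ factorizes as $f=m\,h\,p$ with $p$ a projection associated to $\mathsf{Ker} f$, $h$ an isomorphism and $m$ an embedding associated to $\mathsf{Im} f$. 5. The join of two normal subgroups of a group is normal, and the meet of two conormal subgroups of a group is conormal. *Zigzags.* A zigzag from $X_0$ to $X_n$ ($n\ge 0$) consists of groups $X_0,\dots,X_n$ and, for each $1\le i\le n$, a homomorphism $f_i$ which is either $X_{i-1}\to X_i$ (right-pointing) or $X_i\to X_{i-1}$ (left-pointing). Chasing a subgroup of $X_0$ forward to $X_n$ means applying, for $i=1,\dots,n$ in turn, the direct image map of $f_i$ if $f_i$ is right-pointing and its inverse image map if $f_i$ is left-pointing. Chasing a subgroup of $X_n$ backward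 to $X_0$ means chasing it in the same way along the zigzag read from right to left. A zigzag is *collapsible* if all its left-pointing arrows are isomorphisms; it then has a composite $X_0\to X_n$, in which left-pointing arrows are replaced by their inverses. *Pyramids.* A pyramid over a zigzag is a triangular array of groups $X^i_j$, $0\le j\le i\le n$, with $X^i_i=X_i$, which is filled in from the base upwards and in which each node $X^{i+1}_j$ with $j\le i$ is joined to $X^i_j$ on its lower left and to $X^{i+1}_{j+1}$ on its lower right by a homomorphism (in one of the two directions). Over each base arrow $f_i$ one builds a triangle with apex $X^i_{i-1}$ by writing $f_i=me$ with $e$ (from the domain of $f_i$ to the apex) a projection associated to $\mathsf{Ker} f_i$ and $m$ (from the apex to the codomain of $f_i$) an embedding associated to $\mathsf{Im} f_i$. Over each wedge $X^i_{j-1}\,\text{---}\,X^i_j\,\text{---}\,X^{i+1}_j$ ($1\le j\le i<n$) already built, one adds the top node $X^{i+1}_{j-1}$ as follows. * If the wedge consists of $a\colon X^i_j\to X^i_{j-1}$ and $b\colon X^i_j\to X^{i+1}_j$, then the added arrows are $x\colon X^i_{j-1}\to X^{i+1}_{j-1}$ and $y\colon X^{i+1}_j\to X^{i+1}_{j-1}$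 such that $xa=yb$ is a projection associated to $\mathsf{Ker}\,a\vee\mathsf{Ker}\,b$. * Dually, if it consists of $a\colon X^i_{j-1}\to X^i_j$ and $b\colon X^{i+1}_j\to X^i_j$, then the added arrows are $x\colon X^{i+1}_{j-1}\to X^i_{j-1}$ and $y\colon X^{i+1}_{j-1}\to X^{i+1}_j$ such that $ax=by$ is an embedding associated to $\mathsf{Im}\,a\wedge\mathsf{Im}\,b$. * If the two arrows of the wedge are composable, one builds over their composite a triangle with apex $X^{i+1}_{j-1}$, as was done over the base arrows. A zigzag *induces* a homomorphism $f\colon X_0\to X_n$ if there is a pyramid over it and, for every pyramid over it, the zigzag $X^0_0,X^1_0,\dots,X^n_0,X^n_1,\dots,X^n_n$ going up the left side and down the right side of the pyramid is collapsible with composite $f$. *Theorem.* Suppose that, for a zigzag from $X_0$ to $X_n$, chasing the largest and the smallest subgroup of $X_0$ forward yields the largest and the smallest subgroup of $X_n$, respectively, and chasing the largest and the smallest subgroup of $X_n$ backward yields the largest and the smallest subgroup of $X_0$, respectively. Then the zigzag induces a homomorphism $X_0\to X_n$, and this homomorphism is an isomorphism. -/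

import Mathlib

open CategoryTheory

universe w v u

namespace SelfDualGroups

/-- A category (of "groups" and "homomorphisms") in which every object `G` carries a bounded
lattice `Sub G` (of "subgroups"), and every homomorphism `f : X ⟶ Y` carries a direct image map
and an inverse image map forming a Galois connection, functorially in `f`, such that
`f f⁻¹ B = B ∧ Im f` and `f⁻¹ f A = A ∨ Ker f`. -/
class SubgroupForm (C : Type u) [Category.{v} C] where
  /-- The subgroups of a group. -/
  Sub : C → Type w
  /-- Subgroup inclusion is a lattice order. -/
  [lattice : ∀ X : C, Lattice (Sub X)]
  /-- Every group has a largest and a smallest subgroup. -/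
  [boundedOrder : ∀ X : C, BoundedOrder (Sub X)]
  /-- The direct image of a subgroup under a homomorphism. -/
  direct : ∀ {X Y : C}, (X ⟶ Y) → Sub X → Sub Y
  /-- The inverse image of a subgroup under a homomorphism. -/
  inverse : ∀ {X Y : C}, (X ⟶ Y) → Sub Y → Sub X
  direct_le_iff : ∀ {X Y : C} (f : X ⟶ Y) (A : Sub X) (B : Sub Y),
    direct f A ≤ B ↔ A ≤ inverse f B
  direct_id : ∀ {X : C} (A : Sub X), direct (𝟙 X) A = A
  inverse_id : ∀ {X : C} (A : Sub X), inverse (𝟙 X) A = A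
  direct_comp : ∀ {X Y Z : C} (f : X ⟶ Y) (g : Y ⟶ Z) (A : Sub X),
    direct (f ≫ g) A = direct g (direct f A)
  inverse_comp : ∀ {X Y Z : C} (f : X ⟶ Y) (g : Y ⟶ Z) (B : Sub Z),
    inverse (f ≫ g) B = inverse f (inverse g B)
  direct_inverse : ∀ {X Y : C} (f : X ⟶ Y) (B : Sub Y),
    direct f (inverse f B) = B ⊓ direct f ⊤
  inverse_direct : ∀ {X Y : C} (f : X ⟶ Y) (A : Sub X),
    inverse f (direct f A) = A ⊔ inverse f ⊥

attribute [reducible, instance] SubgroupForm.lattice SubgroupForm.boundedOrder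

open SubgroupForm

section Language

variable {C : Type u} [Category.{v} C] [SubgroupForm.{w} C]

/-- The image of a homomorphism: the direct image of the largest subgroup. -/
def im {X Y : C} (f : X ⟶ Y) : Sub Y := direct f ⊤

/-- The kernel of a homomorphism: the inverse image of the trivial subgroup. -/
def ker {X Y : C} (f : X ⟶ Y) : Sub X := inverse f ⊥

/-- A subgroup is normal when it is the kernel of some homomorphism. -/
def IsNormal {G : C} (S : Sub G) : Prop := ∃ (H : C) (f : G ⟶ H), ker f = S

/-- A subgroup is conormal when it is the image of some homomorphism. -/
def IsConormal {G : C} (S : Sub G) : Prop := ∃ (F : C) (f : F ⟶ G), im f = S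

/-- `m` is an embedding associated to the subgroup `S`. -/
structure IsEmbeddingFor {M G : C} (m : M ⟶ G) (S : Sub G) : Prop where
  im_le : im m ≤ S
  existsUnique_lift : ∀ {U : C} (f : U ⟶ G), im f ≤ S → ∃! k : U ⟶ M, k ≫ m = f

/-- `p` is a projection associated to the subgroup `S`. -/
structure IsProjectionFor {G Q : C} (p : G ⟶ Q) (S : Sub G) : Prop where
  le_ker : S ≤ ker p
  existsUnique_desc : ∀ {V : C} (g : G ⟶ V), S ≤ ker g → ∃! k : Q ⟶ V, p ≫ k = g

end Language

/-- The self-dual axioms on top of those of `SubgroupForm`: conormal subgroups have embeddings and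
normal subgroups have projections; every homomorphism is a projection associated to its kernel,
followed by an isomorphism, followed by an embedding associated to its image; joins of two normal
subgroups are normal and meets of two conormal subgroups are conormal. -/
class SelfDualAxioms (C : Type u) [Category.{v} C] [SubgroupForm.{w} C] : Prop where
  exists_embedding : ∀ {G : C} (S : Sub G), IsConormal S →
    ∃ (M : C) (m : M ⟶ G), IsEmbeddingFor m S
  exists_projection : ∀ {G : C} (S : Sub G), IsNormal S →
    ∃ (Q : C) (p : G ⟶ Q), IsProjectionFor p S
  exists_factorization : ∀ {X Y : C} (f : X ⟶ Y),
    ∃ (Q M : C) (p : X ⟶ Q) (h : Q ≅ M) (m : M ⟶ Y),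
      IsProjectionFor p (ker f) ∧ IsEmbeddingFor m (im f) ∧ f = p ≫ h.hom ≫ m
  isNormal_sup : ∀ {G : C} (A B : Sub G), IsNormal A → IsNormal B → IsNormal (A ⊔ B)
  isConormal_inf : ∀ {G : C} (A B : Sub G), IsConormal A → IsConormal B → IsConormal (A ⊓ B)

/-- One place of a zigzag, from the node `X` on the left to the node `Y` on the right: a
homomorphism with its arrowhead on the right or on the left. -/
inductive Link {C : Type u} [Category.{v} C] (X Y : C) : Type v
  | right (f : X ⟶ Y) : Link X Y
  | left (f : Y ⟶ X) : Link X Y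

/-- Zigzags of homomorphisms with initial node `X` and final node `Y`. -/
inductive Zigzag {C : Type u} [Category.{v} C] : C → C → Type (max u v)
  | nil (X : C) : Zigzag X X
  | cons {X Y Z : C} (a : Link X Y) (z : Zigzag Y Z) : Zigzag X Z

section Zigzags

variable {C : Type u} [Category.{v} C]

/-- A place of a zigzag admits collapsing when its arrow, if left-pointing, is an isomorphism. -/
def Link.IsCollapsible {X Y : C} : Link X Y → Prop
  | .right _ => True
  | .left f => IsIso f

/-- The homomorphism contributed by one place of a collapsible zigzag: the arrow itself if it is
right-pointing, its inverse if it is left-pointing. -/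
noncomputable def Link.hom {X Y : C} : (a : Link X Y) → a.IsCollapsible → (X ⟶ Y)
  | .right f, _ => f
  | .left f, h => @inv _ _ _ _ f h

/-- Concatenation of zigzags. -/
def Zigzag.append {X Y Z : C} : Zigzag X Y → Zigzag Y Z → Zigzag X Z
  | .nil _, z' => z'
  | .cons a z, z' => .cons a (z.append z')

/-- A zigzag is collapsible when all its left-pointing arrows are isomorphisms. -/
def Zigzag.IsCollapsible {X Y : C} : Zigzag X Y → Prop
  | .nil _ => True
  | .cons a z => a.IsCollapsible ∧ z.IsCollapsible

/-- The composite of a collapsible zigzag, left-pointing arrows being replaced by their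
inverses. -/
noncomputable def Zigzag.collapse {X Y : C} : (z : Zigzag X Y) → z.IsCollapsible → (X ⟶ Y)
  | .nil X, _ => 𝟙 X
  | .cons a z, h => a.hom h.1 ≫ z.collapse h.2

variable [SubgroupForm.{w} C]

/-- Chasing a subgroup forward across one place of a zigzag. -/
def Link.chase {X Y : C} : Link X Y → Sub X → Sub Y
  | .right f, S => direct f S
  | .left f, S => inverse f S

/-- Chasing a subgroup backward across one place of a zigzag. -/
def Link.chaseBack {X Y : C} : Link X Y → Sub Y → Sub X
  | .right f, T => inverse f T
  | .left f, T => direct f T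

/-- Chasing a subgroup of the initial node forward along a zigzag. -/
def Zigzag.chase {X Y : C} : Zigzag X Y → Sub X → Sub Y
  | .nil _, S => S
  | .cons a z, S => z.chase (a.chase S)

/-- Chasing a subgroup of the final node backward along a zigzag. -/
def Zigzag.chaseBack {X Y : C} : Zigzag X Y → Sub Y → Sub X
  | .nil _, T => T
  | .cons a z, T => a.chaseBack (z.chaseBack T)

/-- `Triangle a up down`: the triangle with base `a`, from `X` to `Y`, and with apex `T`, obtained
by factorizing the homomorphism in `a` as a projection `e` associated to its kernel followed by an
embedding `m` associated to its image. The sides are read from left to right, so `up` is the place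
from `X` to `T` and `down` is the place from `T` to `Y`. -/
inductive Triangle : {X T Y : C} → Link X Y → Link X T → Link T Y → Prop
  | right {X T Y : C} (f : X ⟶ Y) (e : X ⟶ T) (m : T ⟶ Y)
      (he : IsProjectionFor e (ker f)) (hm : IsEmbeddingFor m (im f)) (hf : e ≫ m = f) :
      Triangle (.right f) (.right e) (.right m)
  | left {X T Y : C} (f : Y ⟶ X) (e : Y ⟶ T) (m : T ⟶ X)
      (he : IsProjectionFor e (ker f)) (hm : IsEmbeddingFor m (im f)) (hf : e ≫ m = f) :
      Triangle (.left f) (.left m) (.left e)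

/-- `Diamond a b up down`: the diamond with left node `L`, bottom node `B`, right node `R` and top
node `T`, whose bottom wedge consists of `a` (from `L` to `B`) and `b` (from `B` to `R`), and whose
top wedge consists of `up` (from `L` to `T`) and `down` (from `T` to `R`). -/
inductive Diamond : {L B R T : C} → Link L B → Link B R → Link L T → Link T R → Prop
  /-- Both bottom arrows point upwards: the projection diamond. -/
  | projection {L B R T : C} (n : B ⟶ L) (r : B ⟶ R) (p : B ⟶ T) (x : L ⟶ T) (y : R ⟶ T)
      (hp : IsProjectionFor p (ker n ⊔ ker r)) (hx : n ≫ x = p) (hy : r ≫ y = p) :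
      Diamond (.left n) (.right r) (.right x) (.left y)
  /-- Both bottom arrows point downwards: the embedding diamond. -/
  | embedding {L B R T : C} (n : L ⟶ B) (r : R ⟶ B) (p : T ⟶ B) (x : T ⟶ L) (y : T ⟶ R)
      (hp : IsEmbeddingFor p (im n ⊓ im r)) (hx : x ≫ n = p) (hy : y ≫ r = p) :
      Diamond (.right n) (.left r) (.left x) (.right y)
  /-- Both bottom arrows point to the right: a triangle is built over their composite. -/
  | right {L B R T : C} (m₁ : L ⟶ B) (e₁ : B ⟶ R) (up : Link L T) (down : Link T R)
      (h : Triangle (.right (m₁ ≫ e₁)) up down) :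
      Diamond (.right m₁) (.right e₁) up down
  /-- Both bottom arrows point to the left: a triangle is built over their composite. -/
  | left {L B R T : C} (e₁ : B ⟶ L) (m₁ : R ⟶ B) (up : Link L T) (down : Link T R)
      (h : Triangle (.left (m₁ ≫ e₁)) up down) :
      Diamond (.left e₁) (.left m₁) up down

/-- `Strip d l l' d'`: a strip of diamonds, each of them sharing a side with the next one, between
two ascending parallel zigzags: `l` on the lower right and `l'` on the upper left. The place `d`
connects their initial nodes, the place `d'` connects their final nodes, and each further
connection is created as the top wedge of a diamond is added to its bottom wedge. -/
inductive Strip : {T Y B A : C} → Link T Y → Zigzag Y A → Zigzag T B → Link B A → Prop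
  | nil {T Y : C} (d : Link T Y) : Strip d (.nil Y) (.nil T) d
  | cons {T Y T₁ Y₁ B A : C} {d : Link T Y} {b : Link Y Y₁} {up : Link T T₁} {down : Link T₁ Y₁}
      {l : Zigzag Y₁ A} {l' : Zigzag T₁ B} {d' : Link B A}
      (h : Diamond d b up down) (hs : Strip down l l' d') :
      Strip d (.cons b l) (.cons up l') d'

/-- `IsPyramid z l r`: the zigzag `z`, with nodes `X₀, …, Xₙ`, is the base of a pyramid having `l`
(read upwards, from `X₀` to the top node `A`) as its left side and `r` (read downwards, from `A` to
`Xₙ`) as its right side. The pyramid over `X₀ - X₁ - ⋯ - Xₙ` consists of the pyramid over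
`X₁ - ⋯ - Xₙ`, of the triangle over the base arrow between `X₀` and `X₁`, and of the strip of
diamonds which that triangle makes one build upwards along the left side of the smaller pyramid.
Thus there is one triangle over each base arrow and, above the triangles, one diamond over each
wedge formed by adjacent triangles or diamonds. -/
inductive IsPyramid : {X Y A : C} → Zigzag X Y → Zigzag X A → Zigzag A Y → Prop
  | nil (X : C) : IsPyramid (.nil X) (.nil X) (.nil X)
  | cons {X X₁ T Y A B : C} {a : Link X X₁} {up : Link X T} {down : Link T X₁}
      {z : Zigzag X₁ Y} {l : Zigzag X₁ A} {r : Zigzag A Y} {l' : Zigzag T B} {d : Link B A}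
      (ht : Triangle a up down) (hs : Strip down l l' d) (hp : IsPyramid z l r) :
      IsPyramid (.cons a z) (.cons up l') (.cons d r)

/-- The zigzag `z` induces the homomorphism `f`: a pyramid can be built over `z`, and for every
such pyramid, the principal horizontal zigzag (up along the left side, then down along the right
side) is collapsible, with composite `f`. -/
structure Zigzag.Induces {X Y : C} (z : Zigzag X Y) (f : X ⟶ Y) : Prop where
  exists_pyramid : ∃ (A : C) (l : Zigzag X A) (r : Zigzag A Y), IsPyramid z l r
  collapse_eq : ∀ {A : C} (l : Zigzag X A) (r : Zigzag A Y), IsPyramid z l r →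
    ∃ h : (l.append r).IsCollapsible, (l.append r).collapse h = f

end Zigzags

end SelfDualGroups

/-!
In a pyramid every arrow on an ascending side is a right-pointing surjection or a left-pointing
injection, and every arrow on a descending side is a right-pointing injection or a left-pointing
surjection; here "surjection" means image `⊤` and "injection" means kernel `⊥`. By the
factorization axiom, surjections are exactly the projections associated to their kernels,
injections are exactly the embeddings associated to their images, and an arrow which is both is an
isomorphism. This makes it possible to add every diamond, so pyramids exist
(`exists_isPyramid`).

Chasing subgroups across the bottom of a triangle or diamond gives the same result as chasing them
across its top, so chasing along the base of a pyramid agrees with chasing up the left side and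
then down the right side (`IsPyramid.chase_eq`, `IsPyramid.chaseBack_eq`). Chasing down a
descending side is injective on subgroups, and chasing up an ascending side fixes `⊤` and `⊥`.
Hence if forward chasing along the base preserves `⊤` and `⊥`, so does each single arrow of the
right side, and this says precisely that each of these arrows is an isomorphism. Backward chasing
gives the same for the left side.

It remains to see that the composite isomorphism does not depend on the pyramid. Each triangle and
each diamond is determined by its bottom up to an isomorphism of its apex, so any two pyramids over
isomorphic bases are isomorphic (`IsPyramid.intertwines`), and isomorphic collapsible zigzags have
conjugate composites (`Zigzag.Intertwines.collapse_comm`).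
-/

namespace SelfDualGroups

open SubgroupForm

section Forms

/-! ### Images, kernels, projections and embeddings -/

variable {C : Type u} [Category.{v} C] [SubgroupForm.{w} C]

theorem gc_direct_inverse {X Y : C} (f : X ⟶ Y) :
    GaloisConnection (direct f) (inverse f) :=
  direct_le_iff f

theorem im_comp {X Y Z : C} (f : X ⟶ Y) (g : Y ⟶ Z) : im (f ≫ g) = direct g (im f) :=
  direct_comp f g ⊤

theorem ker_comp {X Y Z : C} (f : X ⟶ Y) (g : Y ⟶ Z) : ker (f ≫ g) = inverse f (ker g) :=
  inverse_comp f g ⊥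

theorem im_comp_le {X Y Z : C} (f : X ⟶ Y) (g : Y ⟶ Z) : im (f ≫ g) ≤ im g := by
  rw [im_comp]
  exact (gc_direct_inverse g).monotone_l le_top

theorem ker_le_ker_comp {X Y Z : C} (f : X ⟶ Y) (g : Y ⟶ Z) : ker f ≤ ker (f ≫ g) := by
  rw [ker_comp]
  exact (gc_direct_inverse f).monotone_u bot_le

theorem direct_inverse_of_im_eq_top {X Y : C} {f : X ⟶ Y} (h : im f = ⊤) (B : Sub Y) :
    direct f (inverse f B) = B := by
  rw [direct_inverse, ← im, h, inf_top_eq]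

theorem inverse_direct_of_ker_eq_bot {X Y : C} {f : X ⟶ Y} (h : ker f = ⊥) (A : Sub X) :
    inverse f (direct f A) = A := by
  rw [inverse_direct, ← ker, h, sup_bot_eq]

theorem direct_ker {X Y : C} (f : X ⟶ Y) : direct f (ker f) = ⊥ := by
  rw [ker, direct_inverse, bot_inf_eq]

theorem inverse_im {X Y : C} (f : X ⟶ Y) : inverse f (im f) = ⊤ := by
  rw [im, inverse_direct, top_sup_eq]

theorem im_eq_top_of_isIso {X Y : C} (f : X ⟶ Y) [IsIso f] : im f = ⊤ := by
  have h := im_comp_le (inv f) f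
  rw [IsIso.inv_hom_id, im, direct_id] at h
  exact top_le_iff.mp h

theorem ker_eq_bot_of_isIso {X Y : C} (f : X ⟶ Y) [IsIso f] : ker f = ⊥ := by
  have h := ker_le_ker_comp f (inv f)
  rw [IsIso.hom_inv_id, ker, ker, inverse_id] at h
  exact le_bot_iff.mp h

theorem im_comp_of_im_eq_top {X Y Z : C} {f : X ⟶ Y} (h : im f = ⊤) (g : Y ⟶ Z) :
    im (f ≫ g) = im g := by
  rw [im_comp, h, im]

theorem ker_comp_of_ker_eq_bot {X Y Z : C} (f : X ⟶ Y) {g : Y ⟶ Z} (h : ker g = ⊥) :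
    ker (f ≫ g) = ker f := by
  rw [ker_comp, h, ker]

theorem direct_iso_hom {X Y : C} (i : X ≅ Y) (A : Sub X) :
    direct i.hom A = inverse i.inv A := by
  conv_lhs => rw [← inverse_id A, ← i.hom_inv_id, inverse_comp]
  exact direct_inverse_of_im_eq_top (im_eq_top_of_isIso _) _

theorem inverse_iso_hom {X Y : C} (i : X ≅ Y) (B : Sub Y) :
    inverse i.hom B = direct i.inv B :=
  (direct_iso_hom i.symm B).symm

theorem IsProjectionFor.epi {G Q : C} {p : G ⟶ Q} {S : Sub G} (hp : IsProjectionFor p S) :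
    Epi p where
  left_cancellation _ b h :=
    (hp.existsUnique_desc (p ≫ b) (hp.le_ker.trans (ker_le_ker_comp _ _))).unique h rfl

theorem IsEmbeddingFor.mono {M G : C} {m : M ⟶ G} {S : Sub G} (hm : IsEmbeddingFor m S) :
    Mono m where
  right_cancellation _ b h :=
    (hm.existsUnique_lift (b ≫ m) ((im_comp_le _ _).trans hm.im_le)).unique h rfl

theorem IsProjectionFor.ker_eq {G Q : C} {p : G ⟶ Q} {S : Sub G} (hp : IsProjectionFor p S)
    (hS : IsNormal S) : ker p = S := by
  obtain ⟨H, f, rfl⟩ := hS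
  obtain ⟨k, rfl, -⟩ := hp.existsUnique_desc f le_rfl
  exact le_antisymm (ker_le_ker_comp _ _) hp.le_ker

theorem IsEmbeddingFor.im_eq {M G : C} {m : M ⟶ G} {S : Sub G} (hm : IsEmbeddingFor m S)
    (hS : IsConormal S) : im m = S := by
  obtain ⟨F, f, rfl⟩ := hS
  obtain ⟨k, rfl, -⟩ := hm.existsUnique_lift f le_rfl
  exact le_antisymm hm.im_le (im_comp_le _ _)

theorem IsProjectionFor.exists_iso {G Q Q' : C} {p : G ⟶ Q} {q : G ⟶ Q'} {S : Sub G}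
    (hp : IsProjectionFor p S) (hq : IsProjectionFor q S) : ∃ t : Q ≅ Q', p ≫ t.hom = q := by
  have := hp.epi
  have := hq.epi
  obtain ⟨k, hk, -⟩ := hp.existsUnique_desc q hq.le_ker
  obtain ⟨l, hl, -⟩ := hq.existsUnique_desc p hp.le_ker
  exact ⟨⟨k, l, by rw [← cancel_epi p, reassoc_of% hk, hl, Category.comp_id],
    by rw [← cancel_epi q, reassoc_of% hl, hk, Category.comp_id]⟩, hk⟩

theorem IsEmbeddingFor.exists_iso {M M' G : C} {m : M ⟶ G} {n : M' ⟶ G} {S : Sub G}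
    (hm : IsEmbeddingFor m S) (hn : IsEmbeddingFor n S) : ∃ t : M ≅ M', t.hom ≫ n = m := by
  have := hm.mono
  have := hn.mono
  obtain ⟨k, hk, -⟩ := hn.existsUnique_lift m hm.im_le
  obtain ⟨l, hl, -⟩ := hm.existsUnique_lift n hn.im_le
  exact ⟨⟨k, l, by rw [← cancel_mono m, Category.assoc, hl, hk, Category.id_comp],
    by rw [← cancel_mono n, Category.assoc, hk, hl, Category.id_comp]⟩, hk⟩

theorem IsProjectionFor.comp_isIso {G Q Q' : C} {p : G ⟶ Q} {S : Sub G}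
    (hp : IsProjectionFor p S) (t : Q ⟶ Q') [IsIso t] : IsProjectionFor (p ≫ t) S where
  le_ker := hp.le_ker.trans (ker_le_ker_comp _ _)
  existsUnique_desc g hg := by
    have := hp.epi
    obtain ⟨k, hk, -⟩ := hp.existsUnique_desc g hg
    exact ⟨inv t ≫ k, by simpa using hk, fun l hl => by
      rw [← cancel_epi (p ≫ t), hl]; simpa using hk.symm⟩

theorem IsEmbeddingFor.isIso_comp {M M' G : C} {m : M ⟶ G} {S : Sub G}
    (hm : IsEmbeddingFor m S) (t : M' ⟶ M) [IsIso t] : IsEmbeddingFor (t ≫ m) S where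
  im_le := (im_comp_le _ _).trans hm.im_le
  existsUnique_lift g hg := by
    have := hm.mono
    obtain ⟨k, hk, -⟩ := hm.existsUnique_lift g hg
    exact ⟨k ≫ inv t, by simpa using hk, fun l hl => by
      rw [← cancel_mono (t ≫ m), hl]; simpa using hk.symm⟩

theorem IsProjectionFor.iso_comp {G G' Q : C} {p : G' ⟶ Q} {S : Sub G'}
    (hp : IsProjectionFor p S) (i : G ≅ G') :
    IsProjectionFor (i.hom ≫ p) (inverse i.hom S) where
  le_ker := by
    rw [ker_comp]
    exact (gc_direct_inverse _).monotone_u hp.le_ker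
  existsUnique_desc g hg := by
    have := hp.epi
    obtain ⟨k, hk, -⟩ := hp.existsUnique_desc (i.inv ≫ g) (by
      rwa [ker_comp, ← direct_le_iff, ← inverse_iso_hom])
    exact ⟨k, by simp [hk], fun l hl => by
      rw [← cancel_epi (i.hom ≫ p), hl]; simp [hk]⟩

theorem IsEmbeddingFor.comp_iso {M G G' : C} {m : M ⟶ G} {S : Sub G}
    (hm : IsEmbeddingFor m S) (i : G ≅ G') :
    IsEmbeddingFor (m ≫ i.hom) (direct i.hom S) where
  im_le := by
    rw [im_comp]
    exact (gc_direct_inverse _).monotone_l hm.im_le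
  existsUnique_lift g hg := by
    have := hm.mono
    obtain ⟨k, hk, -⟩ := hm.existsUnique_lift (g ≫ i.inv) (by
      rwa [im_comp, direct_le_iff, ← direct_iso_hom])
    exact ⟨k, by simp [reassoc_of% hk], fun l hl => by
      rw [← cancel_mono (m ≫ i.hom), hl]; simp [reassoc_of% hk]⟩

theorem IsProjectionFor.isIso {G Q : C} {p : G ⟶ Q} (hp : IsProjectionFor p ⊥) : IsIso p := by
  have := hp.epi
  obtain ⟨k, hk, -⟩ := hp.existsUnique_desc (𝟙 G) bot_le
  exact ⟨k, hk, by rw [← cancel_epi p, reassoc_of% hk, Category.comp_id]⟩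

theorem IsEmbeddingFor.isIso {M G : C} {m : M ⟶ G} (hm : IsEmbeddingFor m ⊤) : IsIso m := by
  have := hm.mono
  obtain ⟨k, hk, -⟩ := hm.existsUnique_lift (𝟙 G) le_top
  exact ⟨k, by rw [← cancel_mono m, Category.assoc, hk, Category.id_comp, Category.comp_id], hk⟩

/-- The middle node of a factorization is determined by the projection alone; the compatibility of
the second factors follows because projections are epimorphisms. -/
theorem exists_iso_of_factorizations {X Y X' Y' T T' : C} {i : X ≅ X'} {j : Y ≅ Y'} {f : X ⟶ Y}
    {f' : X' ⟶ Y'} (h : f ≫ j.hom = i.hom ≫ f') {e : X ⟶ T} {m : T ⟶ Y} {e' : X' ⟶ T'}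
    {m' : T' ⟶ Y'} (he : IsProjectionFor e (ker f)) (he' : IsProjectionFor e' (ker f'))
    (hf : e ≫ m = f) (hf' : e' ≫ m' = f') :
    ∃ t : T ≅ T', e ≫ t.hom = i.hom ≫ e' ∧ m ≫ j.hom = t.hom ≫ m' := by
  have hk : inverse i.hom (ker f') = ker f := by
    rw [← ker_comp, ← h, ker_comp_of_ker_eq_bot _ (ker_eq_bot_of_isIso j.hom)]
  obtain ⟨t, ht⟩ := he.exists_iso (hk ▸ he'.iso_comp i)
  have := he.epi
  refine ⟨t, ht, ?_⟩
  rw [← cancel_epi e, reassoc_of% ht, hf', reassoc_of% hf, h]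

/-! ### Surjections and injections under the self-dual axioms -/

section SelfDual

variable [SelfDualAxioms C]

/-- The isomorphism in the middle of a factorization is absorbed into the projection. -/
theorem exists_projection_comp_embedding {X Y : C} (f : X ⟶ Y) :
    ∃ (T : C) (e : X ⟶ T) (m : T ⟶ Y),
      IsProjectionFor e (ker f) ∧ IsEmbeddingFor m (im f) ∧ e ≫ m = f := by
  obtain ⟨Q, M, p, h, m, hp, hm, hf⟩ := SelfDualAxioms.exists_factorization f
  exact ⟨M, p ≫ h.hom, m, hp.comp_isIso h.hom, hm, by simp [hf]⟩

theorem isProjectionFor_ker {X Y : C} {f : X ⟶ Y} (hf : im f = ⊤) :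
    IsProjectionFor f (ker f) := by
  obtain ⟨T, e, m, he, hm, h⟩ := exists_projection_comp_embedding f
  rw [hf] at hm
  have := hm.isIso
  have := he.comp_isIso m
  rwa [h] at this

theorem isEmbeddingFor_im {X Y : C} {f : X ⟶ Y} (hf : ker f = ⊥) :
    IsEmbeddingFor f (im f) := by
  obtain ⟨T, e, m, he, hm, h⟩ := exists_projection_comp_embedding f
  rw [hf] at he
  have := he.isIso
  have := hm.isIso_comp e
  rwa [h] at this

theorem isIso_of_im_eq_top_of_ker_eq_bot {X Y : C} {f : X ⟶ Y} (hi : im f = ⊤)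
    (hk : ker f = ⊥) : IsIso f := by
  have h := isProjectionFor_ker hi
  rw [hk] at h
  exact h.isIso

theorem IsProjectionFor.im_eq_top {G Q : C} {p : G ⟶ Q} {S : Sub G} (hp : IsProjectionFor p S)
    (hS : IsNormal S) : im p = ⊤ := by
  obtain ⟨T, e, m, he, hm, h⟩ := exists_projection_comp_embedding p
  have := hp.epi
  have := hm.mono
  -- The embedding part of `p` is a split epimorphism, because `e` factors through `p`.
  obtain ⟨k, hk, -⟩ := hp.existsUnique_desc e ((hp.ker_eq hS).symm.trans_le he.le_ker)
  have hkm : k ≫ m = 𝟙 _ := by rw [← cancel_epi p, reassoc_of% hk, h, Category.comp_id]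
  have : IsIso m :=
    ⟨k, by rw [← cancel_mono m, Category.assoc, hkm, Category.id_comp, Category.comp_id], hkm⟩
  exact top_le_iff.mp ((im_eq_top_of_isIso m).symm.trans_le hm.im_le)

theorem IsEmbeddingFor.ker_eq_bot {M G : C} {m : M ⟶ G} {S : Sub G} (hm : IsEmbeddingFor m S)
    (hS : IsConormal S) : ker m = ⊥ := by
  obtain ⟨T, e, n, he, hn, h⟩ := exists_projection_comp_embedding m
  have := he.epi
  have := hm.mono
  -- The projection part of `m` is a split monomorphism, because `n` factors through `m`.
  obtain ⟨k, hk, -⟩ := hm.existsUnique_lift n (hn.im_le.trans_eq (hm.im_eq hS))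
  have hek : e ≫ k = 𝟙 _ := by rw [← cancel_mono m, Category.assoc, hk, h, Category.id_comp]
  have : IsIso e :=
    ⟨k, hek, by rw [← cancel_epi e, reassoc_of% hek, Category.comp_id]⟩
  exact le_bot_iff.mp (he.le_ker.trans_eq (ker_eq_bot_of_isIso e))

end SelfDual

end Forms

section Pyramids

variable {C : Type u} [Category.{v} C]

/-! ### Ascending, descending and invertible places -/

/-- Every place of the zigzag satisfies `P`. -/
def Zigzag.All (P : ∀ {X Y : C}, Link X Y → Prop) {X Y : C} : Zigzag X Y → Prop
  | .nil _ => True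
  | .cons a z => P a ∧ z.All P

/-- The arrow at this place, in whichever direction it points, is an isomorphism. -/
def Link.IsInvertible {X Y : C} : Link X Y → Prop
  | .right f => IsIso f
  | .left f => IsIso f

theorem Zigzag.All.append {P : ∀ {X Y : C}, Link X Y → Prop} {X Y Z : C} {z : Zigzag X Y}
    {z' : Zigzag Y Z} (h : z.All P) (h' : z'.All P) : (z.append z').All P := by
  induction z with
  | nil => exact h'
  | cons a z ih => exact ⟨h.1, ih h.2 h'⟩

theorem Zigzag.All.isCollapsible {X Y : C} {z : Zigzag X Y} (h : z.All Link.IsInvertible) :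
    z.IsCollapsible := by
  induction z with
  | nil => trivial
  | cons a z ih =>
    refine ⟨?_, ih h.2⟩
    cases a with
    | right f => trivial
    | left f => exact h.1

theorem Zigzag.All.isIso_collapse {X Y : C} {z : Zigzag X Y} (h : z.All Link.IsInvertible)
    (hc : z.IsCollapsible) : IsIso (z.collapse hc) := by
  induction z with
  | nil => exact IsIso.id _
  | cons a z ih =>
    have h₂ := ih h.2 hc.2
    have h₁ : IsIso (a.hom hc.1) := by
      cases a with
      | right f => exact h.1
      | left f =>
        have : IsIso f := h.1
        exact (inferInstance : IsIso (inv f))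
    exact IsIso.comp_isIso' h₁ h₂

/-! ### Isomorphisms of zigzags -/

/-- The isomorphisms `i` and `j` between the end nodes carry the arrow at one place to the arrow at
the other; both arrows have to point in the same direction. -/
def Link.Intertwines {X Y X' Y' : C} (i : X ≅ X') (j : Y ≅ Y') : Link X Y → Link X' Y' → Prop
  | .right f, .right f' => f ≫ j.hom = i.hom ≫ f'
  | .left f, .left f' => f ≫ i.hom = j.hom ≫ f'
  | _, _ => False

/-- Isomorphisms between corresponding nodes, being `i` at the initial and `j` at the final nodes,
carry each arrow of one zigzag to the corresponding arrow of the other. -/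
inductive Zigzag.Intertwines : {X Y X' Y' : C} → (X ≅ X') → (Y ≅ Y') → Zigzag X Y →
    Zigzag X' Y' → Prop
  | nil {X X' : C} (i : X ≅ X') : Zigzag.Intertwines i i (.nil X) (.nil X')
  | cons {X Y Z X' Y' Z' : C} {i : X ≅ X'} {j : Y ≅ Y'} {k : Z ≅ Z'} {a : Link X Y}
      {a' : Link X' Y'} {z : Zigzag Y Z} {z' : Zigzag Y' Z'} (ha : a.Intertwines i j a')
      (hz : Zigzag.Intertwines j k z z') : Zigzag.Intertwines i k (.cons a z) (.cons a' z')

theorem Link.Intertwines.refl {X Y : C} (a : Link X Y) :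
    a.Intertwines (Iso.refl X) (Iso.refl Y) a := by
  cases a <;> simp [Link.Intertwines]

theorem Zigzag.Intertwines.refl {X Y : C} (z : Zigzag X Y) :
    z.Intertwines (Iso.refl X) (Iso.refl Y) z := by
  induction z with
  | nil => exact .nil _
  | cons a z ih => exact .cons (.refl a) ih

theorem Zigzag.Intertwines.append {X Y Z X' Y' Z' : C} {i : X ≅ X'} {j : Y ≅ Y'} {k : Z ≅ Z'}
    {z : Zigzag X Y} {z' : Zigzag X' Y'} {t : Zigzag Y Z} {t' : Zigzag Y' Z'}
    (h : z.Intertwines i j z') (h' : t.Intertwines j k t') :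
    (z.append t).Intertwines i k (z'.append t') := by
  induction h with
  | nil => exact h'
  | cons ha _ ih => exact .cons ha (ih h')

theorem Zigzag.Intertwines.collapse_comm {X Y X' Y' : C} {i : X ≅ X'} {j : Y ≅ Y'}
    {z : Zigzag X Y} {z' : Zigzag X' Y'} (h : z.Intertwines i j z') (hz : z.IsCollapsible)
    (hz' : z'.IsCollapsible) : z.collapse hz ≫ j.hom = i.hom ≫ z'.collapse hz' := by
  induction h with
  | nil => simp [Zigzag.collapse]
  | @cons X Y Z X' Y' Z' i j k a a' z z' ha _ ih =>
    have h₁ : a.hom hz.1 ≫ j.hom = i.hom ≫ a'.hom hz'.1 := by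
      cases a with
      | right f =>
        cases a' with
        | right f' => exact ha
        | left f' => exact ha.elim
      | left f =>
        cases a' with
        | right f' => exact ha.elim
        | left f' =>
          have : IsIso f := hz.1
          have : IsIso f' := hz'.1
          have ha : f ≫ i.hom = j.hom ≫ f' := ha
          change inv f ≫ j.hom = i.hom ≫ inv f'
          simp [ha]
    simp only [Zigzag.collapse, Category.assoc]
    rw [ih hz.2 hz'.2, reassoc_of% h₁]

variable [SubgroupForm.{w} C]

/-- A place of the kind found on ascending sides of a pyramid: a right-pointing surjection or a
left-pointing injection. -/
def Link.IsAscending {X Y : C} : Link X Y → Prop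
  | .right f => im f = ⊤
  | .left f => ker f = ⊥

/-- A place of the kind found on descending sides of a pyramid: a right-pointing injection or a
left-pointing surjection. -/
def Link.IsDescending {X Y : C} : Link X Y → Prop
  | .right f => ker f = ⊥
  | .left f => im f = ⊤

/-! ### Chasing along ascending and descending zigzags -/

theorem Link.chase_mono {X Y : C} (a : Link X Y) : Monotone a.chase := by
  cases a with
  | right f => exact (gc_direct_inverse f).monotone_l
  | left f => exact (gc_direct_inverse f).monotone_u

theorem Link.chaseBack_mono {X Y : C} (a : Link X Y) : Monotone a.chaseBack := by
  cases a with
  | right f => exact (gc_direct_inverse f).monotone_u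
  | left f => exact (gc_direct_inverse f).monotone_l

theorem Zigzag.chase_mono {X Y : C} (z : Zigzag X Y) : Monotone z.chase := by
  induction z with
  | nil => exact monotone_id
  | cons a z ih => exact ih.comp a.chase_mono

theorem Zigzag.chaseBack_mono {X Y : C} (z : Zigzag X Y) : Monotone z.chaseBack := by
  induction z with
  | nil => exact monotone_id
  | cons a z ih => exact a.chaseBack_mono.comp ih

theorem Link.IsAscending.chase_chaseBack {X Y : C} {a : Link X Y} (h : a.IsAscending)
    (T : Sub Y) : a.chase (a.chaseBack T) = T := by
  cases a with
  | right f => exact direct_inverse_of_im_eq_top h T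
  | left f => exact inverse_direct_of_ker_eq_bot h T

theorem Link.IsDescending.chaseBack_chase {X Y : C} {a : Link X Y} (h : a.IsDescending)
    (S : Sub X) : a.chaseBack (a.chase S) = S := by
  cases a with
  | right f => exact inverse_direct_of_ker_eq_bot h S
  | left f => exact direct_inverse_of_im_eq_top h S

theorem Zigzag.chase_chaseBack {X Y : C} {z : Zigzag X Y} (h : z.All Link.IsAscending)
    (T : Sub Y) : z.chase (z.chaseBack T) = T := by
  induction z with
  | nil => rfl
  | cons a z ih => simp only [Zigzag.chase, Zigzag.chaseBack, h.1.chase_chaseBack, ih h.2]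

theorem Zigzag.chaseBack_chase {X Y : C} {z : Zigzag X Y} (h : z.All Link.IsDescending)
    (S : Sub X) : z.chaseBack (z.chase S) = S := by
  induction z with
  | nil => rfl
  | cons a z ih => simp only [Zigzag.chase, Zigzag.chaseBack, ih h.2, h.1.chaseBack_chase]

theorem Zigzag.chase_top {X Y : C} {z : Zigzag X Y} (h : z.All Link.IsAscending) :
    z.chase ⊤ = ⊤ :=
  top_le_iff.mp ((chase_chaseBack h ⊤).symm.trans_le (z.chase_mono le_top))

theorem Zigzag.chase_bot {X Y : C} {z : Zigzag X Y} (h : z.All Link.IsAscending) :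
    z.chase ⊥ = ⊥ :=
  le_bot_iff.mp ((z.chase_mono bot_le).trans_eq (chase_chaseBack h ⊥))

theorem Zigzag.chaseBack_top {X Y : C} {z : Zigzag X Y} (h : z.All Link.IsDescending) :
    z.chaseBack ⊤ = ⊤ :=
  top_le_iff.mp ((chaseBack_chase h ⊤).symm.trans_le (z.chaseBack_mono le_top))

theorem Zigzag.chaseBack_bot {X Y : C} {z : Zigzag X Y} (h : z.All Link.IsDescending) :
    z.chaseBack ⊥ = ⊥ :=
  le_bot_iff.mp ((z.chaseBack_mono bot_le).trans_eq (chaseBack_chase h ⊥))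

/-! ### Triangles -/

theorem Triangle.chase_eq {X T Y : C} {a : Link X Y} {up : Link X T} {down : Link T Y}
    (h : Triangle a up down) (S : Sub X) : down.chase (up.chase S) = a.chase S := by
  cases h with
  | right f e m he hm hf => subst hf; exact (direct_comp e m S).symm
  | left f e m he hm hf => subst hf; exact (inverse_comp e m S).symm

theorem Triangle.chaseBack_eq {X T Y : C} {a : Link X Y} {up : Link X T} {down : Link T Y}
    (h : Triangle a up down) (S : Sub Y) : up.chaseBack (down.chaseBack S) = a.chaseBack S := by
  cases h with
  | right f e m he hm hf => subst hf; exact (inverse_comp e m S).symm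
  | left f e m he hm hf => subst hf; exact (direct_comp e m S).symm

theorem Triangle.intertwines {X T Y X' T' Y' : C} {a : Link X Y} {up : Link X T}
    {down : Link T Y} {a' : Link X' Y'} {up' : Link X' T'} {down' : Link T' Y'} {i : X ≅ X'}
    {j : Y ≅ Y'} (h : Triangle a up down) (h' : Triangle a' up' down')
    (ha : a.Intertwines i j a') :
    ∃ t : T ≅ T', up.Intertwines i t up' ∧ down.Intertwines t j down' := by
  cases h with
  | right f e m he hm hf =>
    cases h' with
    | right f' e' m' he' hm' hf' => exact exists_iso_of_factorizations ha he he' hf hf'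
    | left f' e' m' he' hm' hf' => exact ha.elim
  | left f e m he hm hf =>
    cases h' with
    | right f' e' m' he' hm' hf' => exact ha.elim
    | left f' e' m' he' hm' hf' =>
      obtain ⟨t, h₁, h₂⟩ := exists_iso_of_factorizations ha he he' hf hf'
      exact ⟨t, h₂, h₁⟩

section SelfDual

variable [SelfDualAxioms C]

/-! ### Invertibility detected by chasing `⊤` and `⊥` -/

theorem Link.IsDescending.isInvertible {X Y : C} {a : Link X Y} (h : a.IsDescending)
    (ht : a.chase ⊤ = ⊤) (hb : a.chase ⊥ = ⊥) : a.IsInvertible := by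
  cases a with
  | right f => exact isIso_of_im_eq_top_of_ker_eq_bot ht h
  | left f => exact isIso_of_im_eq_top_of_ker_eq_bot h hb

theorem Link.IsAscending.isInvertible {X Y : C} {a : Link X Y} (h : a.IsAscending)
    (ht : a.chaseBack ⊤ = ⊤) (hb : a.chaseBack ⊥ = ⊥) : a.IsInvertible := by
  cases a with
  | right f => exact isIso_of_im_eq_top_of_ker_eq_bot h hb
  | left f => exact isIso_of_im_eq_top_of_ker_eq_bot ht h

theorem Zigzag.all_isInvertible_of_isDescending {X Y : C} {z : Zigzag X Y}
    (h : z.All Link.IsDescending) (ht : z.chase ⊤ = ⊤) (hb : z.chase ⊥ = ⊥) :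
    z.All Link.IsInvertible := by
  induction z with
  | nil => trivial
  | cons a z ih =>
    have ht' : a.chase ⊤ = ⊤ := by
      rw [← chaseBack_chase h.2 (a.chase ⊤)]
      exact (congrArg z.chaseBack ht).trans (chaseBack_top h.2)
    have hb' : a.chase ⊥ = ⊥ := by
      rw [← chaseBack_chase h.2 (a.chase ⊥)]
      exact (congrArg z.chaseBack hb).trans (chaseBack_bot h.2)
    simp only [Zigzag.chase, ht', hb'] at ht hb
    exact ⟨h.1.isInvertible ht' hb', ih h.2 ht hb⟩

theorem Zigzag.all_isInvertible_of_isAscending {X Y : C} {z : Zigzag X Y}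
    (h : z.All Link.IsAscending) (ht : z.chaseBack ⊤ = ⊤) (hb : z.chaseBack ⊥ = ⊥) :
    z.All Link.IsInvertible := by
  induction z with
  | nil => trivial
  | @cons X Y Z a z ih =>
    have ht' : z.chaseBack ⊤ = ⊤ := by
      rw [← h.1.chase_chaseBack (z.chaseBack ⊤)]
      exact (congrArg a.chase ht).trans (chase_top (z := .cons a (.nil Y)) ⟨h.1, trivial⟩)
    have hb' : z.chaseBack ⊥ = ⊥ := by
      rw [← h.1.chase_chaseBack (z.chaseBack ⊥)]
      exact (congrArg a.chase hb).trans (chase_bot (z := .cons a (.nil Y)) ⟨h.1, trivial⟩)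
    simp only [Zigzag.chaseBack, ht', hb'] at ht hb
    exact ⟨h.1.isInvertible ht hb, ih h.2 ht' hb'⟩

/-! ### Sides of pyramids -/

theorem isNormal_ker_sup_ker {B L R : C} (n : B ⟶ L) (r : B ⟶ R) :
    IsNormal (ker n ⊔ ker r) :=
  SelfDualAxioms.isNormal_sup _ _ ⟨_, n, rfl⟩ ⟨_, r, rfl⟩

theorem isConormal_im_inf_im {B L R : C} (n : L ⟶ B) (r : R ⟶ B) :
    IsConormal (im n ⊓ im r) :=
  SelfDualAxioms.isConormal_inf _ _ ⟨_, n, rfl⟩ ⟨_, r, rfl⟩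

theorem Triangle.isAscending_isDescending {X T Y : C} {a : Link X Y} {up : Link X T}
    {down : Link T Y} (h : Triangle a up down) : up.IsAscending ∧ down.IsDescending := by
  cases h with
  | right f e m he hm hf => exact ⟨he.im_eq_top ⟨_, f, rfl⟩, hm.ker_eq_bot ⟨_, f, rfl⟩⟩
  | left f e m he hm hf => exact ⟨hm.ker_eq_bot ⟨_, f, rfl⟩, he.im_eq_top ⟨_, f, rfl⟩⟩

theorem Diamond.isAscending_isDescending {L B R T : C} {a : Link L B} {b : Link B R}
    {up : Link L T} {down : Link T R} (h : Diamond a b up down) :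
    up.IsAscending ∧ down.IsDescending := by
  cases h with
  | projection n r p x y hp hx hy =>
    have h := top_le_iff.mpr (hp.im_eq_top (isNormal_ker_sup_ker n r))
    exact ⟨top_le_iff.mp (h.trans (hx ▸ im_comp_le n x)),
      top_le_iff.mp (h.trans (hy ▸ im_comp_le r y))⟩
  | embedding n r p x y hp hx hy =>
    have h := le_bot_iff.mpr (hp.ker_eq_bot (isConormal_im_inf_im n r))
    exact ⟨le_bot_iff.mp (le_trans (hx ▸ ker_le_ker_comp x n) h),
      le_bot_iff.mp (le_trans (hy ▸ ker_le_ker_comp y r) h)⟩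
  | right m₁ e₁ up down h => exact h.isAscending_isDescending
  | left e₁ m₁ up down h => exact h.isAscending_isDescending

theorem Strip.isAscending_isDescending {T Y B A : C} {d : Link T Y} {l : Zigzag Y A}
    {l' : Zigzag T B} {d' : Link B A} (h : Strip d l l' d') (hd : d.IsDescending) :
    l'.All Link.IsAscending ∧ d'.IsDescending := by
  induction h with
  | nil => exact ⟨trivial, hd⟩
  | cons h _ ih =>
    have h₁ := h.isAscending_isDescending
    have h₂ := ih h₁.2
    exact ⟨⟨h₁.1, h₂.1⟩, h₂.2⟩

theorem IsPyramid.isAscending_isDescending {X Y A : C} {z : Zigzag X Y} {l : Zigzag X A}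
    {r : Zigzag A Y} (h : IsPyramid z l r) :
    l.All Link.IsAscending ∧ r.All Link.IsDescending := by
  induction h with
  | nil => exact ⟨trivial, trivial⟩
  | cons ht hs _ ih =>
    have h₁ := ht.isAscending_isDescending
    have h₂ := hs.isAscending_isDescending h₁.2
    exact ⟨⟨h₁.1, h₂.1⟩, ⟨h₂.2, ih.2⟩⟩

/-! ### Existence of pyramids -/

theorem exists_triangle {X Y : C} (a : Link X Y) :
    ∃ (T : C) (up : Link X T) (down : Link T Y), Triangle a up down := by
  cases a with
  | right f =>
    obtain ⟨T, e, m, he, hm, h⟩ := exists_projection_comp_embedding f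
    exact ⟨T, _, _, .right f e m he hm h⟩
  | left f =>
    obtain ⟨T, e, m, he, hm, h⟩ := exists_projection_comp_embedding f
    exact ⟨T, _, _, .left f e m he hm h⟩

theorem exists_diamond {L B R : C} {a : Link L B} {b : Link B R} (ha : a.IsDescending)
    (hb : b.IsAscending) :
    ∃ (T : C) (up : Link L T) (down : Link T R), Diamond a b up down := by
  cases a with
  | right n =>
    cases b with
    | right r =>
      obtain ⟨T, up, down, h⟩ := exists_triangle (.right (n ≫ r))
      exact ⟨T, up, down, .right n r up down h⟩
    | left r =>
      obtain ⟨T, p, hp⟩ := SelfDualAxioms.exists_embedding _ (isConormal_im_inf_im n r)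
      obtain ⟨x, hx, -⟩ := (isEmbeddingFor_im ha).existsUnique_lift p (hp.im_le.trans inf_le_left)
      obtain ⟨y, hy, -⟩ := (isEmbeddingFor_im hb).existsUnique_lift p (hp.im_le.trans inf_le_right)
      exact ⟨T, _, _, .embedding n r p x y hp hx hy⟩
  | left n =>
    cases b with
    | right r =>
      obtain ⟨T, p, hp⟩ := SelfDualAxioms.exists_projection _ (isNormal_ker_sup_ker n r)
      obtain ⟨x, hx, -⟩ :=
        (isProjectionFor_ker ha).existsUnique_desc p (le_sup_left.trans hp.le_ker)
      obtain ⟨y, hy, -⟩ :=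
        (isProjectionFor_ker hb).existsUnique_desc p (le_sup_right.trans hp.le_ker)
      exact ⟨T, _, _, .projection n r p x y hp hx hy⟩
    | left r =>
      obtain ⟨T, up, down, h⟩ := exists_triangle (.left (r ≫ n))
      exact ⟨T, up, down, .left n r up down h⟩

theorem exists_strip {Y A : C} {l : Zigzag Y A} (hl : l.All Link.IsAscending) {T : C}
    {d : Link T Y} (hd : d.IsDescending) :
    ∃ (B : C) (l' : Zigzag T B) (d' : Link B A), Strip d l l' d' := by
  induction l generalizing T with
  | nil => exact ⟨T, .nil T, d, .nil d⟩
  | cons b l ih =>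
    obtain ⟨T₁, up, down, h⟩ := exists_diamond hd hl.1
    obtain ⟨B, l', d', hs⟩ := ih hl.2 h.isAscending_isDescending.2
    exact ⟨B, .cons up l', d', .cons h hs⟩

theorem exists_isPyramid {X Y : C} (z : Zigzag X Y) :
    ∃ (A : C) (l : Zigzag X A) (r : Zigzag A Y), IsPyramid z l r := by
  induction z with
  | nil X => exact ⟨X, _, _, .nil X⟩
  | cons a z ih =>
    obtain ⟨A, l, r, hp⟩ := ih
    obtain ⟨T, up, down, ht⟩ := exists_triangle a
    obtain ⟨B, l', d', hs⟩ :=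
      exists_strip hp.isAscending_isDescending.1 ht.isAscending_isDescending.2
    exact ⟨B, _, _, .cons ht hs hp⟩

/-! ### Chasing along a pyramid -/

/-- The Beck–Chevalley identity for a projection diamond. The hypotheses are symmetric in the two
sides of the diamond, so this covers both directions of chasing. -/
theorem inverse_direct_eq_of_projection {L B R T : C} {n : B ⟶ L} {r : B ⟶ R} {p : B ⟶ T}
    {x : L ⟶ T} {y : R ⟶ T} (hn : im n = ⊤) (hr : im r = ⊤)
    (hp : IsProjectionFor p (ker n ⊔ ker r)) (hx : n ≫ x = p) (hy : r ≫ y = p) (S : Sub L) :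
    inverse y (direct x S) = direct r (inverse n S) := by
  -- The kernel of `y` is the image under `r` of the kernel of `n`.
  have hky : ker y = direct r (ker n) := by
    rw [← direct_inverse_of_im_eq_top hr (ker y), ← ker_comp, hy,
      hp.ker_eq (isNormal_ker_sup_ker n r), (gc_direct_inverse r).l_sup, direct_ker, sup_bot_eq]
  conv_lhs => rw [← direct_inverse_of_im_eq_top hn S, ← direct_comp, hx, ← hy, direct_comp,
    inverse_direct, ← ker, hky]
  exact sup_eq_left.mpr
    ((gc_direct_inverse r).monotone_l ((gc_direct_inverse n).monotone_u bot_le))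

/-- The Beck–Chevalley identity for an embedding diamond, dual to
`inverse_direct_eq_of_projection`. -/
theorem direct_inverse_eq_of_embedding {L B R T : C} {n : L ⟶ B} {r : R ⟶ B} {p : T ⟶ B}
    {x : T ⟶ L} {y : T ⟶ R} (hn : ker n = ⊥) (hr : ker r = ⊥)
    (hp : IsEmbeddingFor p (im n ⊓ im r)) (hx : x ≫ n = p) (hy : y ≫ r = p) (S : Sub L) :
    direct y (inverse x S) = inverse r (direct n S) := by
  -- The image of `y` is the inverse image under `r` of the image of `n`.
  have hiy : im y = inverse r (im n) := by
    rw [← inverse_direct_of_ker_eq_bot hr (im y), ← im_comp, hy,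
      hp.im_eq (isConormal_im_inf_im n r), (gc_direct_inverse r).u_inf, inverse_im, inf_top_eq]
  conv_lhs => rw [← inverse_direct_of_ker_eq_bot hn S, ← inverse_comp, hx, ← hy, inverse_comp,
    direct_inverse, ← im, hiy]
  exact inf_eq_left.mpr
    ((gc_direct_inverse r).monotone_u ((gc_direct_inverse n).monotone_l le_top))

theorem Diamond.chase_eq {L B R T : C} {a : Link L B} {b : Link B R} {up : Link L T}
    {down : Link T R} (h : Diamond a b up down) (ha : a.IsDescending) (hb : b.IsAscending)
    (S : Sub L) : down.chase (up.chase S) = b.chase (a.chase S) := by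
  cases h with
  | projection n r p x y hp hx hy => exact inverse_direct_eq_of_projection ha hb hp hx hy S
  | embedding n r p x y hp hx hy => exact direct_inverse_eq_of_embedding ha hb hp hx hy S
  | right m₁ e₁ up down h => exact (h.chase_eq S).trans (direct_comp _ _ _)
  | left e₁ m₁ up down h => exact (h.chase_eq S).trans (inverse_comp _ _ _)

theorem Diamond.chaseBack_eq {L B R T : C} {a : Link L B} {b : Link B R} {up : Link L T}
    {down : Link T R} (h : Diamond a b up down) (ha : a.IsDescending) (hb : b.IsAscending)
    (S : Sub R) : up.chaseBack (down.chaseBack S) = a.chaseBack (b.chaseBack S) := by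
  cases h with
  | projection n r p x y hp hx hy =>
    exact inverse_direct_eq_of_projection hb ha (sup_comm (ker n) (ker r) ▸ hp) hy hx S
  | embedding n r p x y hp hx hy =>
    exact direct_inverse_eq_of_embedding hb ha (inf_comm (im n) (im r) ▸ hp) hy hx S
  | right m₁ e₁ up down h => exact (h.chaseBack_eq S).trans (inverse_comp _ _ _)
  | left e₁ m₁ up down h => exact (h.chaseBack_eq S).trans (direct_comp _ _ _)

theorem Strip.chase_eq {T Y B A : C} {d : Link T Y} {l : Zigzag Y A} {l' : Zigzag T B}
    {d' : Link B A} (h : Strip d l l' d') (hd : d.IsDescending) (hl : l.All Link.IsAscending)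
    (S : Sub T) : d'.chase (l'.chase S) = l.chase (d.chase S) := by
  induction h with
  | nil => rfl
  | cons h _ ih =>
    exact (ih h.isAscending_isDescending.2 hl.2 _).trans
      (congrArg _ (h.chase_eq hd hl.1 S))

theorem Strip.chaseBack_eq {T Y B A : C} {d : Link T Y} {l : Zigzag Y A} {l' : Zigzag T B}
    {d' : Link B A} (h : Strip d l l' d') (hd : d.IsDescending) (hl : l.All Link.IsAscending)
    (S : Sub A) : l'.chaseBack (d'.chaseBack S) = d.chaseBack (l.chaseBack S) := by
  induction h with
  | nil => rfl
  | cons h _ ih =>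
    exact (congrArg _ (ih h.isAscending_isDescending.2 hl.2 S)).trans
      (h.chaseBack_eq hd hl.1 _)

theorem IsPyramid.chase_eq {X Y A : C} {z : Zigzag X Y} {l : Zigzag X A} {r : Zigzag A Y}
    (h : IsPyramid z l r) (S : Sub X) : r.chase (l.chase S) = z.chase S := by
  induction h with
  | nil => rfl
  | cons ht hs hp ih =>
    simp only [Zigzag.chase]
    rw [hs.chase_eq ht.isAscending_isDescending.2 hp.isAscending_isDescending.1, ih, ht.chase_eq]

theorem IsPyramid.chaseBack_eq {X Y A : C} {z : Zigzag X Y} {l : Zigzag X A} {r : Zigzag A Y}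
    (h : IsPyramid z l r) (S : Sub Y) : l.chaseBack (r.chaseBack S) = z.chaseBack S := by
  induction h with
  | nil => rfl
  | cons ht hs hp ih =>
    simp only [Zigzag.chaseBack]
    rw [hs.chaseBack_eq ht.isAscending_isDescending.2 hp.isAscending_isDescending.1, ih,
      ht.chaseBack_eq]

/-! ### Uniqueness of pyramids up to isomorphism -/

theorem exists_iso_of_projections {L B R T L' B' R' T' : C} {i : L ≅ L'} {j : B ≅ B'}
    {k : R ≅ R'} {n : B ⟶ L} {r : B ⟶ R} {p : B ⟶ T} {x : L ⟶ T} {y : R ⟶ T} {n' : B' ⟶ L'}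
    {r' : B' ⟶ R'} {p' : B' ⟶ T'} {x' : L' ⟶ T'} {y' : R' ⟶ T'} (hn : im n = ⊤) (hr : im r = ⊤)
    (hni : n ≫ i.hom = j.hom ≫ n') (hrk : r ≫ k.hom = j.hom ≫ r')
    (hp : IsProjectionFor p (ker n ⊔ ker r)) (hx : n ≫ x = p) (hy : r ≫ y = p)
    (hp' : IsProjectionFor p' (ker n' ⊔ ker r')) (hx' : n' ≫ x' = p') (hy' : r' ≫ y' = p') :
    ∃ t : T ≅ T', x ≫ t.hom = i.hom ≫ x' ∧ y ≫ t.hom = k.hom ≫ y' := by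
  have hk : inverse j.hom (ker n' ⊔ ker r') = ker n ⊔ ker r := by
    rw [inverse_iso_hom, (gc_direct_inverse _).l_sup, ← inverse_iso_hom, ← inverse_iso_hom,
      ← ker_comp, ← ker_comp, ← hni, ← hrk,
      ker_comp_of_ker_eq_bot _ (ker_eq_bot_of_isIso i.hom),
      ker_comp_of_ker_eq_bot _ (ker_eq_bot_of_isIso k.hom)]
  obtain ⟨t, ht⟩ := hp.exists_iso (hk ▸ hp'.iso_comp j)
  have := (isProjectionFor_ker hn).epi
  have := (isProjectionFor_ker hr).epi
  refine ⟨t, ?_, ?_⟩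
  · rw [← cancel_epi n, reassoc_of% hx, ht, reassoc_of% hni, hx']
  · rw [← cancel_epi r, reassoc_of% hy, ht, reassoc_of% hrk, hy']

theorem exists_iso_of_embeddings {L B R T L' B' R' T' : C} {i : L ≅ L'} {j : B ≅ B'}
    {k : R ≅ R'} {n : L ⟶ B} {r : R ⟶ B} {p : T ⟶ B} {x : T ⟶ L} {y : T ⟶ R} {n' : L' ⟶ B'}
    {r' : R' ⟶ B'} {p' : T' ⟶ B'} {x' : T' ⟶ L'} {y' : T' ⟶ R'} (hn : ker n' = ⊥)
    (hr : ker r' = ⊥) (hni : n ≫ j.hom = i.hom ≫ n') (hrk : r ≫ j.hom = k.hom ≫ r')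
    (hp : IsEmbeddingFor p (im n ⊓ im r)) (hx : x ≫ n = p) (hy : y ≫ r = p)
    (hp' : IsEmbeddingFor p' (im n' ⊓ im r')) (hx' : x' ≫ n' = p') (hy' : y' ≫ r' = p') :
    ∃ t : T ≅ T', x ≫ i.hom = t.hom ≫ x' ∧ y ≫ k.hom = t.hom ≫ y' := by
  have hk : direct j.hom (im n ⊓ im r) = im n' ⊓ im r' := by
    rw [direct_iso_hom, (gc_direct_inverse _).u_inf, ← direct_iso_hom, ← direct_iso_hom,
      ← im_comp, ← im_comp, hni, hrk, im_comp_of_im_eq_top (im_eq_top_of_isIso i.hom),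
      im_comp_of_im_eq_top (im_eq_top_of_isIso k.hom)]
  obtain ⟨t, ht⟩ := (hk ▸ hp.comp_iso j).exists_iso hp'
  have := (isEmbeddingFor_im hn).mono
  have := (isEmbeddingFor_im hr).mono
  refine ⟨t, ?_, ?_⟩
  · rw [← cancel_mono n', Category.assoc, Category.assoc, hx', ht, ← hni, reassoc_of% hx]
  · rw [← cancel_mono r', Category.assoc, Category.assoc, hy', ht, ← hrk, reassoc_of% hy]

theorem Diamond.intertwines {L B R T L' B' R' T' : C} {a : Link L B} {b : Link B R}
    {up : Link L T} {down : Link T R} {a' : Link L' B'} {b' : Link B' R'} {up' : Link L' T'}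
    {down' : Link T' R'} {i : L ≅ L'} {j : B ≅ B'} {k : R ≅ R'} (h : Diamond a b up down)
    (h' : Diamond a' b' up' down') (hia : a.IsDescending) (hib : b.IsAscending)
    (hia' : a'.IsDescending) (hib' : b'.IsAscending) (ha : a.Intertwines i j a')
    (hb : b.Intertwines j k b') :
    ∃ t : T ≅ T', up.Intertwines i t up' ∧ down.Intertwines t k down' := by
  cases h with
  | projection n r p x y hp hx hy =>
    cases h' with
    | projection n' r' p' x' y' hp' hx' hy' =>
      exact exists_iso_of_projections hia hib ha hb hp hx hy hp' hx' hy'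
    | embedding => exact ha.elim
    | right => exact ha.elim
    | left => exact hb.elim
  | embedding n r p x y hp hx hy =>
    cases h' with
    | projection => exact ha.elim
    | embedding n' r' p' x' y' hp' hx' hy' =>
      exact exists_iso_of_embeddings hia' hib' ha hb hp hx hy hp' hx' hy'
    | right => exact hb.elim
    | left => exact ha.elim
  | right m₁ e₁ up down h =>
    cases h' with
    | projection => exact ha.elim
    | embedding => exact hb.elim
    | right m₁' e₁' up' down' h' =>
      have ha : m₁ ≫ j.hom = i.hom ≫ m₁' := ha
      have hb : e₁ ≫ k.hom = j.hom ≫ e₁' := hb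
      refine h.intertwines h' ?_
      change (m₁ ≫ e₁) ≫ k.hom = i.hom ≫ m₁' ≫ e₁'
      rw [Category.assoc, hb, reassoc_of% ha]
    | left => exact ha.elim
  | left e₁ m₁ up down h =>
    cases h' with
    | projection => exact hb.elim
    | embedding => exact ha.elim
    | right => exact ha.elim
    | left e₁' m₁' up' down' h' =>
      have ha : e₁ ≫ i.hom = j.hom ≫ e₁' := ha
      have hb : m₁ ≫ j.hom = k.hom ≫ m₁' := hb
      refine h.intertwines h' ?_
      change (m₁ ≫ e₁) ≫ i.hom = k.hom ≫ m₁' ≫ e₁'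
      rw [Category.assoc, ha, reassoc_of% hb]

theorem Strip.intertwines {T Y B A T' Y' B' A' : C} {d : Link T Y} {l : Zigzag Y A}
    {u : Zigzag T B} {c : Link B A} {d' : Link T' Y'} {l' : Zigzag Y' A'} {u' : Zigzag T' B'}
    {c' : Link B' A'} {i : T ≅ T'} {j : Y ≅ Y'} {k : A ≅ A'} (h : Strip d l u c)
    (h' : Strip d' l' u' c') (hid : d.IsDescending) (hil : l.All Link.IsAscending)
    (hid' : d'.IsDescending) (hil' : l'.All Link.IsAscending) (hd : d.Intertwines i j d')
    (hl : l.Intertwines j k l') :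
    ∃ t : B ≅ B', u.Intertwines i t u' ∧ c.Intertwines t k c' := by
  induction h generalizing T' Y' B' A' with
  | nil d =>
    cases hl with
    | nil =>
      cases h' with
      | nil => exact ⟨i, .nil i, hd⟩
  | cons h hs ih =>
    cases hl with
    | cons hb hl =>
      cases h' with
      | cons h' hs' =>
        obtain ⟨t, hu, hw⟩ := h.intertwines h' hid hil.1 hid' hil'.1 hd hb
        obtain ⟨s, hu', hc⟩ := ih hs' h.isAscending_isDescending.2 hil.2
          h'.isAscending_isDescending.2 hil'.2 hw hl
        exact ⟨s, .cons hu hu', hc⟩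

theorem IsPyramid.intertwines {X Y A X' Y' A' : C} {z : Zigzag X Y} {l : Zigzag X A}
    {r : Zigzag A Y} {z' : Zigzag X' Y'} {l' : Zigzag X' A'} {r' : Zigzag A' Y'} {i : X ≅ X'}
    {j : Y ≅ Y'} (h : IsPyramid z l r) (h' : IsPyramid z' l' r') (hz : z.Intertwines i j z') :
    ∃ t : A ≅ A', l.Intertwines i t l' ∧ r.Intertwines t j r' := by
  induction h generalizing X' Y' A' with
  | nil X =>
    cases hz with
    | nil =>
      cases h' with
      | nil => exact ⟨i, .nil i, .nil i⟩
  | cons ht hs hp ih =>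
    cases hz with
    | cons ha hz =>
      cases h' with
      | cons ht' hs' hp' =>
        obtain ⟨t, hu, hd⟩ := ht.intertwines ht' ha
        obtain ⟨s, hl, hr⟩ := ih hp' hz
        obtain ⟨q, hl', hd'⟩ := hs.intertwines hs' ht.isAscending_isDescending.2
          hp.isAscending_isDescending.1 ht'.isAscending_isDescending.2
          hp'.isAscending_isDescending.1 hd hl
        exact ⟨q, .cons hu hl', .cons hd' hr⟩

/-! ### The induced isomorphism -/

theorem IsPyramid.all_isInvertible {X Y A : C} {z : Zigzag X Y} {l : Zigzag X A}
    {r : Zigzag A Y} (h : IsPyramid z l r) (forward_top : z.chase ⊤ = ⊤)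
    (forward_bot : z.chase ⊥ = ⊥) (backward_top : z.chaseBack ⊤ = ⊤)
    (backward_bot : z.chaseBack ⊥ = ⊥) : (l.append r).All Link.IsInvertible := by
  obtain ⟨hl, hr⟩ := h.isAscending_isDescending
  rw [← h.chase_eq, Zigzag.chase_top hl] at forward_top
  rw [← h.chase_eq, Zigzag.chase_bot hl] at forward_bot
  rw [← h.chaseBack_eq, Zigzag.chaseBack_top hr] at backward_top
  rw [← h.chaseBack_eq, Zigzag.chaseBack_bot hr] at backward_bot
  exact (Zigzag.all_isInvertible_of_isAscending hl backward_top backward_bot).append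
    (Zigzag.all_isInvertible_of_isDescending hr forward_top forward_bot)

end SelfDual

end Pyramids

end SelfDualGroups

theorem mainTheorem2 {C : Type u} [Category.{v} C]
    [SelfDualGroups.SubgroupForm.{w} C] [SelfDualGroups.SelfDualAxioms C]
    {X Y : C} (z : SelfDualGroups.Zigzag X Y)
    (forward_top : z.chase ⊤ = ⊤) (forward_bot : z.chase ⊥ = ⊥)
    (backward_top : z.chaseBack ⊤ = ⊤) (backward_bot : z.chaseBack ⊥ = ⊥) :
    ∃ f : X ⟶ Y, z.Induces f ∧ IsIso f := by
  obtain ⟨A, l, r, h⟩ := SelfDualGroups.exists_isPyramid z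
  have hi := h.all_isInvertible forward_top forward_bot backward_top backward_bot
  refine ⟨(l.append r).collapse hi.isCollapsible, ⟨⟨A, l, r, h⟩, fun l' r' h' => ?_⟩,
    hi.isIso_collapse _⟩
  have hi' := h'.all_isInvertible forward_top forward_bot backward_top backward_bot
  obtain ⟨t, hl, hr⟩ := h'.intertwines h (.refl z)
  exact ⟨hi'.isCollapsible,
    by simpa using (hl.append hr).collapse_comm hi'.isCollapsible hi.isCollapsible⟩
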